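/- Let $p>3$ be a prime, let $q$ be a power of $p$, and let $r$ be a positive integer. Let $\mathcal M$ be the generalized Artin–Mumford curve, i.e. the projective closure of the plane curve $(X^q-X)(Y^q-Y)=1$, regarded over $\mathbb F_{q^r}$, with function field $L=\mathbb F_{q^r}(x,y)$, $(x^q-x)(y^q-y)=1$. Let $\Sigma$ be the linear system of all (possibly reducible) conics passing through $O_1=(1:0:0)$ and $O_2=(0:1:0)$, and let $V\subset L$ be the $\mathbb F_{q^r}$-space of all functions $H(x,y,1)$, where $H\in\mathbb F_{q^r}[X,Y,Z]$ runs over the quadratic forms vanishing at $O_1$ and $O_2$. Then $\dim V=4$, and the $\mathbb F_{q^r}$-Frobenius order sequence $(\nu_0,\nu_1,\nu_2)$ of $\mathcal M$ with respect to $\Sigma$ exists and is independent of choices: for every separating variable $\tau$ of $L/\mathbb F_{q^r}$ and every basis $f_0,\dots,f_3$ of $V$, it is the lexicographically smallest sequence of non-negative integers such that the $4\times4$ determinant with rows $$\bigl(f_j^{\,q^r}\bigr)_{0\le j\le 3},\qquad \bigl(D_\tau^{(\nu_i)}f_j\bigr)_{0\le j\le 3}\quad(i=0,1,2)$$ is non-zero,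 where $D_\tau^{(n)}$ denotes the $n$-th Hasse derivative with respect to $\tau$. Moreover $\mathcal M$ is $\mathbb F_{q^r}$-Frobenius non-classical with respect to $\Sigma$, that is, $(\nu_0,\nu_1,\nu_2)\neq(0,1,2)$, if and only if $r=2$. -/

import Mathlib

open scoped Polynomial

noncomputable section

namespace ArtinMumford

/-! ### Hasse derivatives and Frobenius order sequences in a function field -/

section FunctionField

variable (k : Type*) [Field k] {L : Type*} [Field L] [Algebra k L]

/-- `τ` is a separating variable of the function field `L / k` in one variable:
`τ` is transcendental over `k` and `L` is separable (algebraic) over `k(τ)`. -/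
def IsSeparatingVariable (τ : L) : Prop :=
  Transcendental k τ ∧ Algebra.IsSeparable (IntermediateField.adjoin k {τ}) L

/-- `D` is the family of Hasse derivatives `D n = D_τ^(n)` of `L / k` with respect to `τ`:
the `k`-linear maps with `D 0 = id`, the Leibniz rule
`D n (g h) = ∑ i + j = n, D i g * D j h`, `D 1 τ = 1` and `D n τ = 0` for `n ≥ 2`.
(Equivalently `g ↦ ∑ n, D n g * T ^ n` is a homomorphism of `k`-algebras `L → L⟦T⟧`
that lifts the identity and sends `τ` to `τ + T`.)
If `τ` is a separating variable, there is exactly one such family. -/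
structure IsHasseDerivatives (τ : L) (D : ℕ → L →ₗ[k] L) : Prop where
  zero : D 0 = LinearMap.id
  leibniz : ∀ (n : ℕ) (g h : L),
    D n (g * h) = ∑ ij ∈ Finset.HasAntidiagonal.antidiagonal n, D ij.1 g * D ij.2 h
  one_var : D 1 τ = 1
  var : ∀ n : ℕ, 2 ≤ n → D n τ = 0

variable {k} in
/-- The square matrix with first row `f_0 ^ Q, …, f_N ^ Q` and further rows
`D (ν i) f_0, …, D (ν i) f_N` for `i < N`. -/
def frobeniusMatrix (Q : ℕ) (D : ℕ → L →ₗ[k] L) {N : ℕ} (f : Fin (N + 1) → L)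
    (ν : Fin N → ℕ) : Matrix (Fin (N + 1)) (Fin (N + 1)) L :=
  Matrix.of (Fin.cons (fun j => f j ^ Q) fun i j => D (ν i) (f j))

variable {k} in
/-- `k` is a finite field, `V ⊆ L` is the `k`-space of functions that defines a linear series of
dimension `N` over `k`. The sequence `ν` is the `k`-Frobenius order sequence of the series: for
every separating variable `τ` and every basis `f_0, …, f_N` of `V`, it is the lexicographically
smallest sequence of non-negative integers for which the matrix with rows `f_j ^ #k` and
`D_τ^(ν i) f_j` has non-zero determinant. -/
def IsFrobeniusOrderSequence (V : Submodule k L) {N : ℕ} (ν : Fin N → ℕ) : Prop :=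
  Module.finrank k V = N + 1 ∧
  (∃ τ : L, IsSeparatingVariable k τ) ∧
  ∀ τ : L, IsSeparatingVariable k τ → ∀ f : Module.Basis (Fin (N + 1)) k V,
    ∃ D : ℕ → L →ₗ[k] L, IsHasseDerivatives k τ D ∧
      IsLeast {μ : Lex (Fin N → ℕ) |
        (frobeniusMatrix (Nat.card k) D (fun j => (f j : L)) (ofLex μ)).det ≠ 0} (toLex ν)

variable {k} in
/-- The linear series is `k`-Frobenius non-classical: its `k`-Frobenius order sequence differs
from `(0, 1, …, N - 1)`. -/
def IsFrobeniusNonclassical (V : Submodule k L) : Prop :=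
  ∃ (N : ℕ) (ν : Fin N → ℕ), IsFrobeniusOrderSequence V ν ∧ ν ≠ fun i : Fin N => (i : ℕ)

end FunctionField

/-! ### The generalized Artin–Mumford curve and its function field -/

section Curve

/-- The polynomial `(X ^ q - X) (Y ^ q - Y) - 1` in `k[X][Y]`; the inner variable is `X`. -/
def curvePoly (k : Type*) [Field k] (q : ℕ) : k[X][X] :=
  Polynomial.C (Polynomial.X ^ q - Polynomial.X) * (Polynomial.X ^ q - Polynomial.X) - 1

/-- The polynomial is irreducible: its reciprocal polynomial in `Y` is an Eisenstein polynomial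
at the prime `X`. -/
theorem curvePoly_irreducible (k : Type*) [Field k] (q : ℕ) (hq : 2 ≤ q) :
    Irreducible (curvePoly k q) := by
  obtain ⟨n, rfl⟩ : ∃ n, q = n + 2 := ⟨q - 2, by omega⟩
  set A : k[X] := Polynomial.X ^ (n + 2) - Polynomial.X with hA
  have hAX : A = Polynomial.X * (Polynomial.X ^ (n + 1) - 1) := by rw [hA]; ring
  have hA0 : A ≠ 0 := by
    intro h
    have := congrArg (fun p : k[X] => p.coeff 1) h
    simp [hA, Polynomial.coeff_X_pow] at this
  have hAsq : ¬ Polynomial.X ^ 2 ∣ A := by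
    intro h
    rw [Polynomial.X_pow_dvd_iff] at h
    have := h 1 (by norm_num)
    simp [hA, Polynomial.coeff_X_pow] at this
  set f : k[X][X] := curvePoly k (n + 2) with hf
  have hf' : f = Polynomial.C A * Polynomial.X ^ (n + 2) + (- Polynomial.C A * Polynomial.X - 1) := by
    rw [hf, curvePoly]; ring
  have hlow : (- Polynomial.C A * Polynomial.X - 1 : k[X][X]).natDegree < n + 2 := by
    have : (- Polynomial.C A * Polynomial.X - 1 : k[X][X]).natDegree ≤ 1 := by compute_degree
    omega
  have hfdeg : f.natDegree = n + 2 := by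
    rw [hf', Polynomial.natDegree_add_eq_left_of_natDegree_lt]
    · exact Polynomial.natDegree_C_mul_X_pow _ _ hA0
    · rw [Polynomial.natDegree_C_mul_X_pow _ _ hA0]; exact hlow
  have hf0 : f ≠ 0 := by
    intro h; rw [h] at hfdeg; simp at hfdeg
  have hfc : f.coeff 0 = -1 := by
    rw [hf']; simp
  set g : k[X][X] := Polynomial.X ^ (n + 2) +
    (Polynomial.C A * Polynomial.X ^ (n + 1) - Polynomial.C A) with hg
  have hrev : f.reverse = -g := by
    have h1 : f = Polynomial.C A * Polynomial.X ^ (n + 2) - Polynomial.C A * Polynomial.X ^ 1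
        - Polynomial.C 1 := by rw [hf']; simp; ring
    rw [Polynomial.reverse, hfdeg, h1, Polynomial.reflect_sub, Polynomial.reflect_sub,
      Polynomial.reflect_C_mul_X_pow, Polynomial.reflect_C_mul_X_pow, Polynomial.reflect_C,
      Polynomial.revAt_le le_rfl, Polynomial.revAt_le (by omega)]
    simp [hg]
    ring
  have hglow : (Polynomial.C A * Polynomial.X ^ (n + 1) - Polynomial.C A : k[X][X]).degree
      < ((n + 2 : ℕ) : WithBot ℕ) := by
    have : (Polynomial.C A * Polynomial.X ^ (n + 1) - Polynomial.C A : k[X][X]).degree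
      ≤ ((n + 1 : ℕ) : WithBot ℕ) := by
      compute_degree
      exact max_le le_rfl (by exact_mod_cast Nat.zero_le _)
    exact this.trans_lt (by exact_mod_cast Nat.lt_succ_self _)
  have hgm : g.Monic := Polynomial.monic_X_pow_add hglow
  have hgdeg : g.degree = ((n + 2 : ℕ) : WithBot ℕ) := by
    rw [hg, Polynomial.degree_add_eq_left_of_degree_lt] <;> rw [Polynomial.degree_X_pow]
    exact hglow
  have hgi : Irreducible g := by
    have hP : (Ideal.span {(Polynomial.X : k[X])}).IsPrime :=
      (Ideal.span_singleton_prime Polynomial.X_ne_zero).2 Polynomial.prime_X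
    refine Polynomial.irreducible_of_eisenstein_criterion hP ?_ ?_ ?_ ?_ hgm.isPrimitive
    · rw [hgm.leadingCoeff]
      exact fun h => hP.ne_top ((Ideal.eq_top_iff_one _).2 h)
    · intro m hm
      rw [hgdeg] at hm
      have hm' : m < n + 2 := by exact_mod_cast hm
      rw [Ideal.mem_span_singleton, hg, Polynomial.coeff_add, Polynomial.coeff_X_pow,
        if_neg hm'.ne, zero_add, Polynomial.coeff_sub, Polynomial.coeff_C_mul]
      refine dvd_sub (Dvd.dvd.mul_right ⟨_, hAX⟩ _) ?_
      rw [Polynomial.coeff_C]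
      split_ifs
      · exact ⟨_, hAX⟩
      · exact dvd_zero _
    · rw [hgdeg]; exact_mod_cast Nat.succ_pos _
    · rw [Ideal.span_singleton_pow, Ideal.mem_span_singleton]
      have : g.coeff 0 = -A := by simp [hg]
      rw [this, dvd_neg]
      exact hAsq
  have key : ∀ a b : k[X][X], f = a * b → IsUnit a.reverse → IsUnit a := by
    intro a b hab hu
    have hc : IsUnit (a.coeff 0) := by
      refine IsUnit.of_mul_eq_one (-b.coeff 0) ?_
      have h := hfc
      rw [hab, Polynomial.mul_coeff_zero] at h
      rw [mul_neg, h, neg_neg]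
    have hd : a.natDegree = 0 := by
      have h1 := Polynomial.natDegree_eq_zero_of_isUnit hu
      rw [Polynomial.reverse_natDegree,
        Polynomial.natTrailingDegree_eq_zero_of_constantCoeff_ne_zero hc.ne_zero] at h1
      simpa using h1
    rw [Polynomial.eq_C_of_natDegree_eq_zero hd]
    exact hc.map Polynomial.C
  refine ⟨fun h => ?_, fun a b hab => ?_⟩
  · have := Polynomial.natDegree_eq_zero_of_isUnit h
    omega
  · have hr : g = -a.reverse * b.reverse := by
      have h := Polynomial.reverse_mul_of_domain a b
      rw [← hab, hrev] at h
      linear_combination -h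
    rcases hgi.isUnit_or_isUnit hr with h | h
    · exact Or.inl (key a b hab ((IsUnit.neg_iff _).1 h))
    · exact Or.inr (key b a (by rw [hab, mul_comm]) h)

variable (F k : Type*) [Field F] [Finite F] [Field k]

/-- The affine coordinate ring over `k` of the curve `(X ^ q - X) (Y ^ q - Y) = 1`,
where `q` is the order of the finite field `F`. -/
abbrev CoordinateRing : Type _ := AdjoinRoot (curvePoly k (Nat.card F))

instance : IsDomain (CoordinateRing F k) :=
  AdjoinRoot.isDomain_of_prime
    (curvePoly_irreducible k _ (Finite.one_lt_card (α := F))).prime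

/-- The function field over `k` of the curve `(X ^ q - X) (Y ^ q - Y) = 1`, `q = #F`. -/
abbrev FunctionField : Type _ := FractionRing (CoordinateRing F k)

/-- The coordinate function `x`. -/
def coordX : FunctionField F k :=
  algebraMap (CoordinateRing F k) _ (AdjoinRoot.of _ Polynomial.X)

/-- The coordinate function `y`. -/
def coordY : FunctionField F k :=
  algebraMap (CoordinateRing F k) _ (AdjoinRoot.root _)

end Curve

/-! ### Conics through two points and the linear series they cut out -/

/-- The linear system of all (possibly reducible) conics over `k` through
`O₁ = (1 : 0 : 0)` and `O₂ = (0 : 1 : 0)`: the space of ternary quadratic forms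
that vanish at these two points. -/
def conicsThrough (k : Type*) [Field k] : Submodule k (MvPolynomial (Fin 3) k) where
  carrier := {H | H.IsHomogeneous 2 ∧
    MvPolynomial.eval ![1, 0, 0] H = 0 ∧ MvPolynomial.eval ![0, 1, 0] H = 0}
  add_mem' := by
    rintro a b ⟨ha, ha1, ha2⟩ ⟨hb, hb1, hb2⟩
    exact ⟨ha.add hb, by simp [ha1, hb1], by simp [ha2, hb2]⟩
  zero_mem' := ⟨MvPolynomial.isHomogeneous_zero _ _ _, by simp, by simp⟩
  smul_mem' := by
    rintro c a ⟨ha, ha1, ha2⟩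
    refine ⟨(MvPolynomial.homogeneousSubmodule (Fin 3) k 2).smul_mem c ha, ?_, ?_⟩
    · simp [MvPolynomial.smul_eval, ha1]
    · simp [MvPolynomial.smul_eval, ha2]

/-- The space of functions `H(x, y, 1)` on the curve, for `H` in a linear system `S` of forms of
a fixed degree. The linear series cut out by `S` consists of the divisors `div g + E`,
`g ≠ 0` in this space, for a fixed divisor `E`. -/
def restrictSystem (F k : Type*) [Field F] [Finite F] [Field k]
    (S : Submodule k (MvPolynomial (Fin 3) k)) : Submodule k (FunctionField F k) :=
  S.map (MvPolynomial.aeval ![coordX F k, coordY F k, 1]).toLinearMap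

end ArtinMumford

end

/-! The space `V` is spanned by `1, x, y, xy`. Put `A = x^q - x`, `B = y^q - y`, `a = x^Q - x`, `b =
y^Q - y` with `Q = q^r`. Since `q` is a power of `p`, Taylor expansion of `AB = 1` gives, for the
nonconstant parts `U, W` of the expansions of `x, y`, the identity `UW = A W + B U` up to terms of
order at least `q`. So below order `q` the expansion of `xy` depends linearly on those of `x` and
`y`.

Consequently the determinant with orders `(0, 1, n)`, `2 ≤ n ≤ q`, equals `D 1 x` times `c (D n y +
B² D n x)`, minus a correction present only for `n = q`, where `c = Ba + Ab - ab`
(`det_frobeniusMatrix_of_relation`).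

Because `AB = 1`, `c = 1 - (a - A)(b - B)`, and `(a - A)(b - B)` is the `q`-th power of `(∑ A^(q^i))
(∑ A^(-q^i))`, both sums over `i < r - 1`. As `A` is transcendental, this product is `1` exactly
when `r = 2` (`relation_frobenius_eq_zero_iff`). For `r ≠ 2` order `2` already works; for `r = 2`
everything vanishes until `n = q`, where the correction survives (`isLeast_of_relation`). The orders
are thus `(0, 1, 2)` or `(0, 1, q)`. -/

noncomputable section

namespace ArtinMumford

/-! ### Existence of Hasse derivatives -/

/-- Lifting along an adically complete quotient from a formally smooth algebra, in terms of
ring homomorphisms. -/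
theorem exists_ringHom_lift_of_formallySmooth {R A S : Type*} [CommRing R] [CommRing A]
    [Algebra R A] [Algebra.FormallySmooth R A] [CommRing S] (I : Ideal S) [IsAdicComplete I S]
    (φ : R →+* S) (ψ : A →+* S ⧸ I)
    (h : ∀ a, ψ (algebraMap R A a) = Ideal.Quotient.mk I (φ a)) :
    ∃ g : A →+* S, (∀ a, g (algebraMap R A a) = φ a) ∧ ∀ a, Ideal.Quotient.mk I (g a) = ψ a := by
  let := φ.toAlgebra
  let f : A →ₐ[R] S ⧸ I := { ψ with commutes' := h }
  obtain ⟨g, hg⟩ := Algebra.FormallySmooth.exists_mkₐ_comp_eq_of_isAdicComplete f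
  exact ⟨g, g.commutes, fun a => DFunLike.congr_fun hg a⟩

-- Compose `k[τ] → k(τ) → L`: a localization is formally smooth, and a separable algebraic extension
-- is formally étale.
open scoped IntermediateField.algebraAdjoinAdjoin in
theorem formallySmooth_adjoin_of_isSeparable {k L : Type*} [Field k] [Field L] [Algebra k L]
    (τ : L) [Algebra.IsSeparable (IntermediateField.adjoin k {τ}) L] :
    Algebra.FormallySmooth (Algebra.adjoin k {τ}) L := by
  have h1 : Algebra.FormallySmooth (Algebra.adjoin k {τ}) (IntermediateField.adjoin k {τ}) :=
    .of_isLocalization (nonZeroDivisors _)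
  have h2 : Algebra.FormallyEtale (IntermediateField.adjoin k {τ}) L :=
    Algebra.FormallyEtale.of_isSeparable _ L
  exact .comp _ (IntermediateField.adjoin k {τ}) _

open PowerSeries in
/-- The Taylor expansion with respect to a separating variable. -/
theorem IsSeparatingVariable.exists_taylorHom {k L : Type*} [Field k] [Field L] [Algebra k L]
    {τ : L} (hτ : IsSeparatingVariable k τ) :
    ∃ g : L →+* L⟦X⟧, (∀ c : k, g (algebraMap k L c) = C (algebraMap k L c)) ∧
      g τ = C τ + X ∧ ∀ a, constantCoeff (g a) = a := by
  have := hτ.2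
  have := formallySmooth_adjoin_of_isSeparable (k := k) τ
  let e := Polynomial.algEquivOfTranscendental k τ hτ.1
  let s : k[X] →+* L⟦X⟧ := Polynomial.eval₂RingHom (C.comp (algebraMap k L)) (C τ + X)
  let φ : Algebra.adjoin k {τ} →+* L⟦X⟧ := s.comp e.symm.toRingHom
  have hs : ∀ p, constantCoeff (s p) = Polynomial.aeval τ p := by
    intro p
    have : (constantCoeff.comp s) = (Polynomial.aeval (R := k) τ).toRingHom := by
      ext <;> simp [s]
    exact DFunLike.congr_fun this p
  have hφ : ∀ p, φ (e p) = s p := fun p => by simp [φ]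
  have hmk : ∀ f : L⟦X⟧, Ideal.Quotient.mk (Ideal.span {(X : L⟦X⟧)}) f
      = Ideal.Quotient.mk (Ideal.span {(X : L⟦X⟧)}) (C (constantCoeff f)) := by
    intro f
    rw [Ideal.Quotient.eq, Ideal.mem_span_singleton, X_dvd_iff]
    simp
  -- The map being lifted is `L → L⟦X⟧ / (X)` given by constants; on `k[τ]` the lift is prescribed
  -- by `τ ↦ τ + X`.
  obtain ⟨g, hg1, hg2⟩ := exists_ringHom_lift_of_formallySmooth (A := L)
    (Ideal.span {(X : L⟦X⟧)}) φ ((Ideal.Quotient.mk _).comp C) (by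
      intro a
      obtain ⟨p, rfl⟩ := e.surjective a
      rw [hφ, hmk (s p), hs]
      simp [e])
  refine ⟨g, fun c => ?_, ?_, fun a => ?_⟩
  · have := hg1 (e (Polynomial.C c))
    rw [hφ] at this
    simpa [e, s, Polynomial.algEquivOfTranscendental_coe, Subalgebra.algebraMap_def] using this
  · have := hg1 (e Polynomial.X)
    rw [hφ] at this
    simpa [e, s, Polynomial.algEquivOfTranscendental_coe, Subalgebra.algebraMap_def] using this
  · have := hg2 a
    rw [RingHom.comp_apply, Ideal.Quotient.eq, Ideal.mem_span_singleton, X_dvd_iff] at this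
    simpa [sub_eq_zero] using this

open PowerSeries in
theorem IsSeparatingVariable.exists_isHasseDerivatives {k L : Type*} [Field k] [Field L]
    [Algebra k L] {τ : L} (hτ : IsSeparatingVariable k τ) :
    ∃ D : ℕ → L →ₗ[k] L, IsHasseDerivatives k τ D := by
  obtain ⟨g, hk, hg, h0⟩ := hτ.exists_taylorHom
  refine ⟨fun n =>
    { toFun := fun a => coeff n (g a)
      map_add' := fun a b => by simp
      map_smul' := fun c a => by simp [Algebra.smul_def, hk] }, ?_, ?_, ?_, ?_⟩
  · ext a
    simpa using h0 a
  · intro n a b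
    simp [coeff_mul]
  · simp [hg]
  · intro n hn
    simp [hg, coeff_C, coeff_X, show n ≠ 0 by omega, show n ≠ 1 by omega]

/-! ### Taylor homomorphism and first-order calculus -/

section HasseDerivatives

variable {k L : Type*} [Field k] [Field L] [Algebra k L]

open PowerSeries in
/-- The ring homomorphism `g ↦ ∑ n, D n g * T ^ n` attached to a family of Hasse derivatives. -/
def IsHasseDerivatives.taylor {τ : L} {D : ℕ → L →ₗ[k] L} (h : IsHasseDerivatives k τ D) :
    L →+* L⟦X⟧ :=
  have hmul : ∀ a b : L, PowerSeries.mk (fun n => D n (a * b))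
      = PowerSeries.mk (fun n => D n a) * PowerSeries.mk (fun n => D n b) := fun a b => by
    ext n
    simp [coeff_mul, h.leibniz]
  { toFun := fun a => PowerSeries.mk fun n => D n a
    map_zero' := by ext; simp
    map_add' := fun a b => by ext; simp
    map_mul' := hmul
    map_one' := by
      have h1 := hmul 1 1
      rw [mul_one] at h1
      -- The image of `1` is idempotent with constant term `1`, so it is nonzero and can be
      -- cancelled.
      have h0 : PowerSeries.mk (fun n => D n (1 : L)) ≠ 0 := fun h0 => by
        simpa [h.zero] using congrArg (coeff 0) h0
      exact (mul_eq_left₀ h0).1 h1.symm }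

@[simp]
theorem IsHasseDerivatives.coeff_taylor {τ : L} {D : ℕ → L →ₗ[k] L}
    (h : IsHasseDerivatives k τ D) (n : ℕ) (a : L) :
    PowerSeries.coeff n (h.taylor a) = D n a := by
  simp [IsHasseDerivatives.taylor]

theorem IsHasseDerivatives.apply_one {τ : L} {D : ℕ → L →ₗ[k] L}
    (h : IsHasseDerivatives k τ D) {n : ℕ} (hn : n ≠ 0) : D n 1 = 0 := by
  rw [← h.coeff_taylor, map_one, PowerSeries.coeff_one, if_neg hn]

theorem IsHasseDerivatives.apply_zero {τ : L} {D : ℕ → L →ₗ[k] L}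
    (h : IsHasseDerivatives k τ D) (a : L) : D 0 a = a := by
  simp [h.zero]

theorem IsHasseDerivatives.one_mul {τ : L} {D : ℕ → L →ₗ[k] L}
    (h : IsHasseDerivatives k τ D) (a b : L) : D 1 (a * b) = a * D 1 b + D 1 a * b := by
  rw [h.leibniz, show Finset.HasAntidiagonal.antidiagonal 1 = {((0 : ℕ), (1 : ℕ)), (1, 0)} from rfl,
    Finset.sum_pair (by simp), h.zero, LinearMap.id_apply, LinearMap.id_apply]

/-- Elements killed by the first Hasse derivative form a field, so generators of `L` cannot all
be killed. -/
theorem IsHasseDerivatives.exists_one_ne_zero {τ : L} {D : ℕ → L →ₗ[k] L}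
    (h : IsHasseDerivatives k τ D) {S : Set L} (hS : IntermediateField.adjoin k S = ⊤) :
    ∃ a ∈ S, D 1 a ≠ 0 := by
  by_contra! hcon
  have hc : ∀ c : k, D 1 (algebraMap k L c) = 0 := fun c => by
    rw [Algebra.algebraMap_eq_smul_one, map_smul, h.apply_one one_ne_zero, smul_zero]
  have hall : ∀ a ∈ IntermediateField.adjoin k S, D 1 a = 0 := by
    intro a ha
    induction ha using IntermediateField.adjoin_induction with
    | mem a ha => exact hcon a ha
    | algebraMap c => exact hc c
    | add a b _ _ ha hb => rw [map_add, ha, hb, add_zero]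
    | inv a _ ha =>
      rcases eq_or_ne a 0 with rfl | h0
      · simp
      · have h1 := h.one_mul a a⁻¹
        rw [mul_inv_cancel₀ h0, h.apply_one one_ne_zero, ha, zero_mul, add_zero] at h1
        exact (mul_eq_zero.1 h1.symm).resolve_left h0
    | mul a b _ _ ha hb => rw [h.one_mul, ha, hb, mul_zero, zero_mul, add_zero]
  have h1 := hall τ (by rw [hS]; trivial)
  rw [h.one_var] at h1
  exact one_ne_zero h1

/-- The nonconstant part of the Taylor expansion of a product. -/
theorem IsHasseDerivatives.apply_mul {τ : L} {D : ℕ → L →ₗ[k] L}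
    (h : IsHasseDerivatives k τ D) (x y : L) {n : ℕ} (hn : n ≠ 0) :
    D n (x * y) = x * D n y + y * D n x + PowerSeries.coeff n
      ((h.taylor x - PowerSeries.C x) * (h.taylor y - PowerSeries.C y)) := by
  have : (h.taylor x - PowerSeries.C x) * (h.taylor y - PowerSeries.C y) = h.taylor (x * y)
      - PowerSeries.C x * h.taylor y - PowerSeries.C y * h.taylor x
      + PowerSeries.C (x * y) := by
    rw [map_mul, map_mul]; ring
  rw [this]
  simp [PowerSeries.coeff_C, hn, -map_mul]

end HasseDerivatives

/-! ### Frobenius determinants and change of basis -/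

section FrobeniusMatrix

variable {k L : Type*} [Field k] [Finite k] [Field L] [Algebra k L]

theorem sum_smul_pow_natCard {ι : Type*} (s : Finset ι) (c : ι → k) (g : ι → L) :
    (∑ i ∈ s, c i • g i) ^ Nat.card k = ∑ i ∈ s, c i • g i ^ Nat.card k := by
  have := Fintype.ofFinite k
  rw [Nat.card_eq_fintype_card]
  have h := map_sum (FiniteField.frobeniusAlgHom k L) (fun i => c i • g i) s
  simp_rw [map_smul] at h
  exact h

/-- Each row of the Frobenius matrix is additive and `k`-homogeneous in the functions. -/
theorem frobeniusMatrix_sum_smul (D : ℕ → L →ₗ[k] L) {N : ℕ} {ι : Type*} [Fintype ι]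
    (g : Fin (N + 1) → L) (c : Fin (N + 1) → ι → k) (g' : ι → L)
    (hg : ∀ j, g j = ∑ i, c j i • g' i) (ν : Fin N → ℕ) (l j : Fin (N + 1)) :
    frobeniusMatrix (Nat.card k) D g ν l j = ∑ i, c j i •
      (Fin.cons (g' i ^ Nat.card k) (fun m => D (ν m) (g' i)) : Fin (N + 1) → L) l := by
  refine Fin.cases ?_ (fun m => ?_) l
  · simp [frobeniusMatrix, hg, sum_smul_pow_natCard]
  · simp [frobeniusMatrix, hg, map_sum]

/-- A `k`-linear relation among the functions is respected by every row, the `#k`-th powers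
included, so its coefficients form a kernel vector. -/
theorem linearIndependent_of_det_frobeniusMatrix_ne_zero (D : ℕ → L →ₗ[k] L) {N : ℕ}
    (g : Fin (N + 1) → L) (ν : Fin N → ℕ)
    (h : (frobeniusMatrix (Nat.card k) D g ν).det ≠ 0) : LinearIndependent k g := by
  rw [Fintype.linearIndependent_iff]
  intro c hc
  have hv : (frobeniusMatrix (Nat.card k) D g ν).mulVec (fun j => algebraMap k L (c j)) = 0 := by
    ext l
    have h1 : ∀ l, (Fin.cons ((∑ j, c j • g j) ^ Nat.card k)
        (fun m => D (ν m) (∑ j, c j • g j)) : Fin (N + 1) → L) l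
        = ∑ j, c j • frobeniusMatrix (Nat.card k) D g ν l j := by
      intro l
      refine Fin.cases ?_ (fun m => ?_) l
      · simp [frobeniusMatrix, sum_smul_pow_natCard]
      · simp [frobeniusMatrix, map_sum]
    have h2 := h1 l
    rw [hc] at h2
    simp only [Matrix.mulVec, dotProduct, Pi.zero_apply]
    rw [show ∑ j, frobeniusMatrix (Nat.card k) D g ν l j * algebraMap k L (c j)
      = ∑ j, c j • frobeniusMatrix (Nat.card k) D g ν l j from
        Finset.sum_congr rfl fun j _ => by rw [Algebra.smul_def, mul_comm], ← h2]
    refine Fin.cases ?_ (fun m => ?_) l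
    · simp [Nat.card_pos.ne']
    · simp
  intro j
  have := congrFun (Matrix.eq_zero_of_mulVec_eq_zero h hv) j
  simpa using this

/-- A change of basis multiplies the matrix on the right by a matrix with entries in `k`. -/
theorem det_frobeniusMatrix_ne_zero_of_basis (D : ℕ → L →ₗ[k] L) {N : ℕ} {V : Submodule k L}
    (b b' : Module.Basis (Fin (N + 1)) k V) (ν : Fin N → ℕ)
    (h : (frobeniusMatrix (Nat.card k) D (fun j => (b j : L)) ν).det ≠ 0) :
    (frobeniusMatrix (Nat.card k) D (fun j => (b' j : L)) ν).det ≠ 0 := by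
  intro h0
  apply h
  have : frobeniusMatrix (Nat.card k) D (fun j => (b j : L)) ν
      = frobeniusMatrix (Nat.card k) D (fun j => (b' j : L)) ν
        * (b'.toMatrix b).map (algebraMap k L) := by
    ext l j
    rw [frobeniusMatrix_sum_smul D _ (fun j i => b'.toMatrix b i j) (fun i => (b' i : L)) ?_,
      Matrix.mul_apply]
    · refine Finset.sum_congr rfl fun i _ => ?_
      rw [Algebra.smul_def, mul_comm]
      refine congrArg₂ _ ?_ rfl
      refine Fin.cases ?_ (fun m => ?_) l <;> simp [frobeniusMatrix]
    · intro j
      have := congrArg V.subtype (b'.sum_toMatrix_smul_self b j)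
      rw [map_sum] at this
      exact this.symm
  rw [this, Matrix.det_mul, h0, zero_mul]

end FrobeniusMatrix

/-! ### Determinants on the curve -/

section Relation

variable {k L : Type*} [Field k] [Field L] [Algebra k L]

@[simp]
theorem IsHasseDerivatives.constantCoeff_taylor {τ : L} {D : ℕ → L →ₗ[k] L}
    (h : IsHasseDerivatives k τ D) (a : L) : PowerSeries.constantCoeff (h.taylor a) = a := by
  rw [← PowerSeries.coeff_zero_eq_constantCoeff_apply, h.coeff_taylor, h.apply_zero]

open PowerSeries in
/-- The coefficients of the Taylor expansion of `(x ^ q - x) (y ^ q - y) = 1` up to degree `q`. -/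
theorem IsHasseDerivatives.coeff_mul_of_relation {τ : L} {D : ℕ → L →ₗ[k] L}
    (h : IsHasseDerivatives k τ D) (p : ℕ) [Fact p.Prime] [CharP L p] {q m : ℕ} (hq : q = p ^ m)
    {x y : L} (hxy : (x ^ q - x) * (y ^ q - y) = 1) {n : ℕ} (hn : n ≠ 0) (hnq : n ≤ q) :
    coeff n ((h.taylor x - C x) * (h.taylor y - C y))
      = (x ^ q - x) * D n y + (y ^ q - y) * D n x
        - if n = q then (x ^ q - x) * (D 1 y) ^ q + (y ^ q - y) * (D 1 x) ^ q else 0 := by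
  have : CharP L⟦X⟧ p := charP_of_injective_ringHom (C_injective (R := L)) p
  -- Raising to the power `q` is additive, so it pushes the nonconstant part of a Taylor series up
  -- to order at least `q`.
  have hexp : ∀ z : L, ∃ u : L⟦X⟧, h.taylor z - C z = X * u ∧ constantCoeff u = D 1 z ∧
      h.taylor z ^ q = C (z ^ q) + X ^ q * u ^ q := by
    intro z
    obtain ⟨u, hu⟩ : X ∣ h.taylor z - C z := by
      rw [X_dvd_iff]
      simp
    refine ⟨u, hu, ?_, ?_⟩
    · have := congrArg (coeff 1) hu
      rw [coeff_succ_X_mul] at this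
      simpa [coeff_C] using this.symm
    · rw [show h.taylor z = C z + X * u by rw [← hu]; ring, hq, add_pow_char_pow, mul_pow,
        map_pow]
  obtain ⟨u, hu, hu0, hux⟩ := hexp x
  obtain ⟨v, hv, hv0, hvy⟩ := hexp y
  have hrel := congrArg h.taylor hxy
  rw [map_mul, map_sub, map_sub, map_pow, map_pow, map_one, hux, hvy] at hrel
  have hC : (C (x ^ q - x) : L⟦X⟧) * C (y ^ q - y) = 1 := by rw [← map_mul, hxy, map_one]
  have key : (h.taylor x - C x) * (h.taylor y - C y)
      = C (x ^ q - x) * (h.taylor y - C y) + C (y ^ q - y) * (h.taylor x - C x)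
        - X ^ q * (C (x ^ q - x) * v ^ q + C (y ^ q - y) * u ^ q - (h.taylor x - C x) * v ^ q
          - u ^ q * (h.taylor y - C y) + X ^ q * u ^ q * v ^ q) := by
    simp only [map_sub] at hC ⊢
    linear_combination hrel - hC
  rw [key, map_sub, map_add, coeff_C_mul, coeff_C_mul, coeff_X_pow_mul']
  have h1 : ∀ z, coeff n (h.taylor z - C z) = D n z := fun z => by simp [coeff_C, hn]
  rw [h1, h1]
  congr 1
  by_cases hnq' : n = q
  · rw [if_pos hnq'.ge, if_pos hnq', hnq', Nat.sub_self, hu, hv]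
    have hq0 : q ≠ 0 := hnq' ▸ hn
    simp [hu0, hv0, hq0]
  · rw [if_neg (by omega), if_neg hnq']

/-- The product of two series without constant term has no linear term, so `A D 1 y + B D 1 x = 0`;
multiply by `B`. -/
theorem IsHasseDerivatives.one_apply_of_relation {τ : L} {D : ℕ → L →ₗ[k] L}
    (h : IsHasseDerivatives k τ D) (p : ℕ) [Fact p.Prime] [CharP L p] {q m : ℕ} (hq : q = p ^ m)
    (hq1 : 1 < q) {x y : L} (hxy : (x ^ q - x) * (y ^ q - y) = 1) :
    D 1 y = -(y ^ q - y) ^ 2 * D 1 x := by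
  have h1 := h.coeff_mul_of_relation p hq hxy one_ne_zero hq1.le
  rw [if_neg hq1.ne, PowerSeries.coeff_mul,
    show Finset.HasAntidiagonal.antidiagonal 1 = {((0 : ℕ), (1 : ℕ)), (1, 0)} from rfl,
    Finset.sum_pair (by simp)] at h1
  simp only [map_sub, h.coeff_taylor, h.apply_zero, PowerSeries.coeff_zero_C, sub_self, zero_mul,
    mul_zero, add_zero, sub_zero] at h1
  linear_combination (-(y ^ q - y)) * h1 - (D 1 y) * hxy

theorem IsHasseDerivatives.coeff_two_mul {τ : L} {D : ℕ → L →ₗ[k] L}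
    (h : IsHasseDerivatives k τ D) (x y : L) :
    PowerSeries.coeff 2 ((h.taylor x - PowerSeries.C x) * (h.taylor y - PowerSeries.C y))
      = D 1 x * D 1 y := by
  rw [PowerSeries.coeff_mul,
    show Finset.HasAntidiagonal.antidiagonal 2 = {((0 : ℕ), (2 : ℕ)), (1, 1), (2, 0)} from rfl,
    Finset.sum_insert (by simp), Finset.sum_pair (by simp)]
  simp

/-- The Frobenius determinant of `1, x, y, x y` with rows of order `0, 1, n`. -/
theorem IsHasseDerivatives.det_frobeniusMatrix_eq {τ : L} {D : ℕ → L →ₗ[k] L}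
    (h : IsHasseDerivatives k τ D) (Q : ℕ) (x y : L) {n : ℕ} (hn : n ≠ 0) :
    (frobeniusMatrix Q D ![1, x, y, x * y] ![0, 1, n]).det
      = -((x ^ Q - x) * D 1 y - (y ^ Q - y) * D 1 x) * PowerSeries.coeff n
          ((h.taylor x - PowerSeries.C x) * (h.taylor y - PowerSeries.C y))
        - (x ^ Q - x) * (y ^ Q - y) * (D 1 x * D n y - D 1 y * D n x) := by
  have h1 := h.apply_mul x y hn
  have h2 := h.one_mul x y
  have hM : frobeniusMatrix Q D ![1, x, y, x * y] ![0, 1, n] =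
      Matrix.of ![fun j => (![1, x, y, x * y] : Fin 4 → L) j ^ Q,
        fun j => D 0 ((![1, x, y, x * y] : Fin 4 → L) j),
        fun j => D 1 ((![1, x, y, x * y] : Fin 4 → L) j),
        fun j => D n ((![1, x, y, x * y] : Fin 4 → L) j)] := by
    ext i j
    fin_cases i <;> rfl
  rw [hM]
  generalize PowerSeries.coeff n
    ((h.taylor x - PowerSeries.C x) * (h.taylor y - PowerSeries.C y)) = w at *
  simp [Matrix.det_succ_row_zero, Fin.sum_univ_succ, Fin.succAbove, h.apply_zero,
    h.apply_one hn, h.apply_one one_ne_zero, h1, h2, mul_pow]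
  ring

/-- The Frobenius determinant with rows of order `0, 1, n`, on the curve. -/
theorem IsHasseDerivatives.det_frobeniusMatrix_of_relation {τ : L} {D : ℕ → L →ₗ[k] L}
    (h : IsHasseDerivatives k τ D) (p : ℕ) [Fact p.Prime] [CharP L p] {q m : ℕ} (hq : q = p ^ m)
    (hq1 : 1 < q) {x y : L} (hxy : (x ^ q - x) * (y ^ q - y) = 1) (Q : ℕ) {n : ℕ} (hn : n ≠ 0)
    (hnq : n ≤ q) :
    (frobeniusMatrix Q D ![1, x, y, x * y] ![0, 1, n]).det = D 1 x *
      (((y ^ q - y) * (x ^ Q - x) + (x ^ q - x) * (y ^ Q - y) - (x ^ Q - x) * (y ^ Q - y))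
          * (D n y + (y ^ q - y) ^ 2 * D n x)
        - ((y ^ q - y) ^ 2 * (x ^ Q - x) + (y ^ Q - y)) *
          if n = q then (x ^ q - x) * (D 1 y) ^ q + (y ^ q - y) * (D 1 x) ^ q else 0) := by
  rw [h.det_frobeniusMatrix_eq Q x y hn, h.coeff_mul_of_relation p hq hxy hn hnq]
  have h1 := h.one_apply_of_relation p hq hq1 hxy
  generalize (if n = q then (x ^ q - x) * (D 1 y) ^ q + (y ^ q - y) * (D 1 x) ^ q else 0) = s
  rw [h1]
  generalize x ^ q - x = A at *
  generalize y ^ q - y = B at *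
  generalize x ^ Q - x = a at *
  generalize y ^ Q - y = b at *
  generalize D 1 x = u at *
  generalize D n x = un at *
  generalize D n y = vn at *
  linear_combination (a * u * B * vn - B * u * b * un) * hxy

/-- A nonzero Frobenius determinant with three derivative rows has order sequence at least
`(0, 1, n)` if the determinants for `(0, 1, i)`, `2 ≤ i < n`, vanish. -/
theorem le_of_det_frobeniusMatrix_ne_zero (Q : ℕ) (D : ℕ → L →ₗ[k] L) (f : Fin 4 → L) {n : ℕ}
    (hv : ∀ i, 2 ≤ i → i < n → (frobeniusMatrix Q D f ![0, 1, i]).det = 0)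
    (μ : Fin 3 → ℕ) (hμ : (frobeniusMatrix Q D f μ).det ≠ 0) :
    toLex ![0, 1, n] ≤ toLex μ := by
  -- Repeated orders give equal rows, so only the third order could drop below the claimed sequence.
  have hinj : ∀ i j : Fin 3, i ≠ j → μ i ≠ μ j := by
    intro i j hij he
    refine hμ (Matrix.det_zero_of_row_eq (i := i.succ) (j := j.succ) (by simpa using hij) ?_)
    ext l
    simp [frobeniusMatrix, he]
  have h01 := hinj 0 1 (by decide)
  have h02 := hinj 0 2 (by decide)
  have h12 := hinj 1 2 (by decide)
  by_contra! hlt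
  obtain ⟨i, hi, hlt⟩ := hlt
  have hi' : ∀ j, j < i → μ j = (![0, 1, n] : Fin 3 → ℕ) j := hi
  have hlt' : μ i < (![0, 1, n] : Fin 3 → ℕ) i := hlt
  fin_cases i
  · simp at hlt'
  · have h0 : μ 0 = 0 := hi' 0 (by decide)
    have h1 : μ 1 < 1 := hlt'
    omega
  · have h0 : μ 0 = 0 := hi' 0 (by decide)
    have h1 : μ 1 = 1 := hi' 1 (by decide)
    have h2 : μ 2 < n := hlt'
    have hμ' : μ = ![0, 1, μ 2] := by
      ext j; fin_cases j <;> simp [h0, h1]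
    rw [hμ'] at hμ
    exact hμ (hv _ (by omega) h2)

end Relation

/-! ### When the factor `c` vanishes -/

section Transcendental

variable {k L : Type*} [Field k] [Field L] [Algebra k L]

theorem ne_zero_of_transcendental {x : L} (hx : Transcendental k x) : x ≠ 0 :=
  fun h => hx (h ▸ isAlgebraic_zero)

theorem sum_pow_sub_self_pow (p : ℕ) [Fact p.Prime] [CharP L p] {q m : ℕ} (hq : q = p ^ m)
    (x : L) (s : ℕ) : ∑ i ∈ Finset.range s, (x ^ q - x) ^ q ^ i = x ^ q ^ s - x := by
  induction s with
  | zero => simp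
  | succ s ih =>
    rw [Finset.sum_range_succ, ih, show q ^ s = p ^ (m * s) by rw [hq, pow_mul],
      sub_pow_char_pow, ← pow_mul, show q * p ^ (m * s) = q ^ (s + 1) by
        rw [hq, pow_mul, pow_succ']]
    ring

/-- For a transcendental `A` and `s ≠ 1`, the product `(∑ A ^ (q ^ i)) (∑ A ^ (- q ^ i))` over
`i < s` is not `1`. -/
theorem sum_pow_mul_sum_inv_pow_eq_one_iff {q : ℕ} (hq : 1 < q) {A : L}
    (hA : Transcendental k A) (s : ℕ) :
    (∑ i ∈ Finset.range s, A ^ q ^ i) * (∑ i ∈ Finset.range s, A⁻¹ ^ q ^ i) = 1 ↔ s = 1 := by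
  have hA0 : A ≠ 0 := ne_zero_of_transcendental hA
  refine ⟨fun h => ?_, ?_⟩
  swap
  · rintro rfl
    simp [hA0]
  obtain _ | t := s
  · simp at h
  by_contra ht
  have ht0 : t ≠ 0 := by omega
  -- Clearing denominators in the product for `s = t + 1` gives `P * R = X ^ q ^ t`. For `t ≠ 0` the
  -- coefficients of `X` disagree: `1` on the left, `0` on the right.
  let P : k[X] := ∑ i ∈ Finset.range (t + 1), Polynomial.X ^ q ^ i
  let R : k[X] := ∑ i ∈ Finset.range (t + 1), Polynomial.X ^ (q ^ t - q ^ i)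
  have hle : ∀ i ∈ Finset.range (t + 1), q ^ i ≤ q ^ t := fun i hi =>
    Nat.pow_le_pow_right (by omega) (by simpa [Nat.lt_succ_iff] using hi)
  have hR : Polynomial.aeval A R = A ^ q ^ t * ∑ i ∈ Finset.range (t + 1), A⁻¹ ^ q ^ i := by
    simp only [R, map_sum, map_pow, Polynomial.aeval_X, Finset.mul_sum]
    refine Finset.sum_congr rfl fun i hi => ?_
    rw [pow_sub₀ A hA0 (hle i hi), inv_pow]
  have hP : Polynomial.aeval A P = ∑ i ∈ Finset.range (t + 1), A ^ q ^ i := by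
    simp [P]
  have heq : P * R = Polynomial.X ^ q ^ t := by
    refine transcendental_iff_injective.1 hA ?_
    rw [map_mul, hP, hR, map_pow, Polynomial.aeval_X]
    linear_combination (A ^ q ^ t) * h
  have hc := congrArg (fun f => Polynomial.coeff f 1) heq
  have hqt : 1 < q ^ t := Nat.one_lt_pow ht0 hq
  have hP0 : P.coeff 0 = 0 := by
    simp only [P, Polynomial.finsetSum_coeff, Polynomial.coeff_X_pow]
    exact Finset.sum_eq_zero fun i _ => if_neg (pow_pos (by omega) i).ne
  have hP1 : P.coeff 1 = 1 := by
    simp only [P, Polynomial.finsetSum_coeff, Polynomial.coeff_X_pow]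
    rw [Finset.sum_eq_single 0]
    · simp
    · exact fun i _ hi => if_neg (Nat.one_lt_pow hi hq).ne
    · simp
  have hR0 : R.coeff 0 = 1 := by
    simp only [R, Polynomial.finsetSum_coeff, Polynomial.coeff_X_pow]
    rw [Finset.sum_eq_single t]
    · simp
    · intro i hi hit
      have : i < t := lt_of_le_of_ne (by simpa [Nat.lt_succ_iff] using hi) hit
      have := Nat.pow_lt_pow_right hq this
      exact if_neg (by omega)
    · simp
  simp [Polynomial.mul_coeff_one, hP0, hP1, hR0, Polynomial.coeff_X_pow, hqt.ne] at hc

theorem transcendental_pow_sub_self {q : ℕ} (hq : 1 < q) {x : L} (hx : Transcendental k x) :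
    Transcendental k (x ^ q - x) := by
  have h0 : (Polynomial.X ^ q - Polynomial.X : k[X]).natDegree ≠ 0 := by
    rw [FiniteField.X_pow_card_sub_X_natDegree_eq k hq]
    omega
  simpa using hx.aeval _ h0 (mem_nonZeroDivisors_of_ne_zero (Polynomial.leadingCoeff_ne_zero.2
    fun h => h0 (by rw [h, Polynomial.natDegree_zero])))

/-- On the curve, `(a - A) (b - B) = 1` for `a = x ^ (q ^ r) - x`, `b = y ^ (q ^ r) - y` only
if `r = 2`. -/
theorem relation_frobenius_eq_zero_iff (p : ℕ) [Fact p.Prime] [CharP L p] {q m : ℕ}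
    (hq : q = p ^ m) (hq1 : 1 < q) {x y : L} (hx : Transcendental k x)
    (hxy : (x ^ q - x) * (y ^ q - y) = 1) {r : ℕ} (hr : 0 < r) :
    (y ^ q - y) * (x ^ q ^ r - x) + (x ^ q - x) * (y ^ q ^ r - y)
      - (x ^ q ^ r - x) * (y ^ q ^ r - y) = 0 ↔ r = 2 := by
  obtain ⟨s, rfl⟩ : ∃ s, r = s + 1 := ⟨r - 1, by omega⟩
  have hy : y ^ q - y = (x ^ q - x)⁻¹ := (inv_eq_of_mul_eq_one_right hxy).symm
  have h1 := sum_pow_mul_sum_inv_pow_eq_one_iff hq1 (transcendental_pow_sub_self hq1 hx) s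
  rw [← hy, sum_pow_sub_self_pow p hq, sum_pow_sub_self_pow p hq] at h1
  -- This turns `(a - A)(b - B)` into the `q`-th power of the product in `h1`; `h3` removes that
  -- power.
  have h2 : ∀ z : L, z ^ q ^ (s + 1) - z ^ q = (z ^ q ^ s - z) ^ q := by
    intro z
    rw [pow_succ q, pow_mul]
    generalize z ^ q ^ s = w
    rw [hq, sub_pow_char_pow]
  have h3 : ∀ z : L, z ^ q = 1 ↔ z = 1 := by
    intro z
    rw [← sub_eq_zero (a := z), ← pow_eq_zero_iff (n := q) (by omega : q ≠ 0), ← sub_eq_zero, hq,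
      sub_pow_char_pow, one_pow]
  rw [show s + 1 = 2 ↔ s = 1 by omega, ← h1, ← h3, mul_pow, ← h2, ← h2]
  constructor <;> intro h
  · linear_combination hxy - h
  · linear_combination hxy - h

end Transcendental

/-! ### The order sequence for the functions `1, x, y, xy` -/

section IsLeast

variable {k L : Type*} [Field k] [Field L] [Algebra k L]

theorem transcendental_of_relation {q : ℕ} (hq1 : 1 < q) {x y : L} (hx : Transcendental k x)
    (hxy : (x ^ q - x) * (y ^ q - y) = 1) : Transcendental k y := by
  intro hy
  refine transcendental_pow_sub_self hq1 hx ?_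
  rw [← inv_eq_of_mul_eq_one_left hxy]
  exact ((hy.pow q).sub hy).inv

theorem IsHasseDerivatives.isLeast_of_relation {τ : L} {D : ℕ → L →ₗ[k] L}
    (h : IsHasseDerivatives k τ D) (p : ℕ) [Fact p.Prime] [CharP L p] (hp : 3 < p) {q m : ℕ}
    (hq : q = p ^ m) (hm : m ≠ 0) {x y : L} (hx : Transcendental k x)
    (hxy : (x ^ q - x) * (y ^ q - y) = 1) (htop : IntermediateField.adjoin k {x, y} = ⊤)
    {r : ℕ} (hr : 0 < r) :
    IsLeast {μ : Lex (Fin 3 → ℕ) |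
      (frobeniusMatrix (q ^ r) D ![1, x, y, x * y] (ofLex μ)).det ≠ 0}
      (toLex ![0, 1, if r = 2 then q else 2]) := by
  have hpq : p ≤ q := hq ▸ Nat.le_self_pow hm p
  have hq1 : 1 < q := by omega
  have hy := transcendental_of_relation hq1 hx hxy
  have h1 := h.one_apply_of_relation p hq hq1 hxy
  have hB0 : y ^ q - y ≠ 0 := right_ne_zero_of_mul_eq_one hxy
  -- `D 1 y` is a multiple of `D 1 x`, so otherwise both generators of `L` would be killed.
  have hu : D 1 x ≠ 0 := by
    intro hu
    obtain ⟨z, hz, hz0⟩ := h.exists_one_ne_zero htop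
    rcases hz with rfl | rfl
    · exact hz0 hu
    · rw [h1, hu, mul_zero] at hz0
      exact hz0 rfl
  have hc0 := relation_frobenius_eq_zero_iff p hq hq1 hx hxy hr
  have hdet := fun n => h.det_frobeniusMatrix_of_relation p hq hq1 hxy (q ^ r) (n := n)
  refine ⟨?_, fun μ hμ => le_of_det_frobeniusMatrix_ne_zero (q ^ r) D _ ?_ _ hμ⟩
  · rw [Set.mem_ofPred_eq, ofLex_toLex]
    split_ifs with hr2
    · have hc := hc0.2 hr2
      have hqr : 1 < q ^ r := Nat.one_lt_pow hr.ne' hq1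
      have ha := ne_zero_of_transcendental (transcendental_pow_sub_self hqr hx)
      have hb := ne_zero_of_transcendental (transcendental_pow_sub_self hqr hy)
      have hB := transcendental_pow_sub_self hq1 hy
      rw [hdet q (by omega) le_rfl, hc, zero_mul, zero_sub, if_pos rfl]
      have hodd : Odd q := by
        rw [hq]
        exact ((Fact.out : p.Prime).odd_of_ne_two (by omega)).pow
      -- The correction factor at `n = q` is nonzero: times `B` it is `(D 1 x)^q (B² - B^(2q))`, and
      -- `B²` is transcendental. Oddness of `q` fixes the sign.
      have hs : (y ^ q - y) * ((x ^ q - x) * (D 1 y) ^ q + (y ^ q - y) * (D 1 x) ^ q)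
          = (D 1 x) ^ q * ((y ^ q - y) ^ 2 - ((y ^ q - y) ^ 2) ^ q) := by
        rw [h1, neg_mul, hodd.neg_pow, mul_pow]
        linear_combination (-(((y ^ q - y) ^ 2) ^ q * (D 1 x) ^ q)) * hxy
      have hBq : (y ^ q - y) ^ 2 - ((y ^ q - y) ^ 2) ^ q ≠ 0 := by
        rw [← neg_ne_zero, neg_sub]
        exact ne_zero_of_transcendental (transcendental_pow_sub_self hq1 (hB.pow (by norm_num)))
      have hs0 := right_ne_zero_of_mul (hs ▸ mul_ne_zero (pow_ne_zero q hu) hBq)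
      refine mul_ne_zero hu (neg_ne_zero.2 (mul_ne_zero ?_ hs0))
      have : (y ^ q - y) ^ 2 * (x ^ q ^ r - x) + (y ^ q ^ r - y)
          = (y ^ q - y) * ((x ^ q ^ r - x) * (y ^ q ^ r - y)) := by
        linear_combination (y ^ q - y) * hc - (y ^ q ^ r - y) * hxy
      rw [this]
      exact mul_ne_zero hB0 (mul_ne_zero ha hb)
    · have hw := h.coeff_mul_of_relation p hq hxy two_ne_zero (by omega)
      rw [h.coeff_two_mul, if_neg (by omega), h1] at hw
      rw [hdet 2 two_ne_zero (by omega), if_neg (by omega), mul_zero, sub_zero]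
      refine mul_ne_zero hu (mul_ne_zero (fun hc => hr2 (hc0.1 hc)) ?_)
      -- Multiply the order-two identity `D 1 x * D 1 y = A D 2 y + B D 2 x` by `B`.
      have : D 2 y + (y ^ q - y) ^ 2 * D 2 x = -(y ^ q - y) ^ 3 * (D 1 x) ^ 2 := by
        linear_combination (-D 2 y) * hxy - (y ^ q - y) * hw
      rw [this]
      exact mul_ne_zero (neg_ne_zero.2 (pow_ne_zero _ hB0)) (pow_ne_zero _ hu)
  · intro i hi hin
    split_ifs at hin with hr2
    · rw [hdet i (by omega) hin.le, hc0.2 hr2, if_neg hin.ne]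
      ring
    · omega

end IsLeast

/-! ### Separability of `L` over `k(x)` -/

section Separability

variable {k L : Type*} [Field k] [Field L] [Algebra k L]

/-- Roots of Artin-Schreier type polynomials are separable. -/
theorem isSeparable_of_mul_pow_sub_self_eq_one {q : ℕ} (hq : (q : k) = 0) {a : k} {y : L}
    (h : algebraMap k L a * (y ^ q - y) = 1) : IsSeparable k y := by
  have ha : a ≠ 0 := by
    rintro rfl
    simp at h
  let P : k[X] := Polynomial.C a * (Polynomial.X ^ q - Polynomial.X) - Polynomial.C 1
  have hder : Polynomial.derivative P = Polynomial.C (-a) := by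
    rw [Polynomial.derivative_sub, Polynomial.derivative_C_mul, Polynomial.derivative_sub,
      Polynomial.derivative_X_pow, hq, Polynomial.derivative_X, Polynomial.derivative_C]
    simp
  have hP : P.Separable := by
    refine ⟨0, Polynomial.C (-a)⁻¹, ?_⟩
    rw [hder, zero_mul, zero_add, ← Polynomial.C_mul, inv_mul_cancel₀ (neg_ne_zero.2 ha),
      Polynomial.C_1]
  have hPy : Polynomial.aeval y P = 0 := by
    simp [P, h]
  exact hP.of_dvd (minpoly.dvd _ _ hPy)

theorem isSeparable_of_relation {q : ℕ} (hq : (q : k) = 0) {x y : L}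
    (hxy : (x ^ q - x) * (y ^ q - y) = 1) (htop : IntermediateField.adjoin k {x, y} = ⊤) :
    Algebra.IsSeparable (IntermediateField.adjoin k {x}) L := by
  have hy : IsSeparable (IntermediateField.adjoin k {x}) y :=
    isSeparable_of_mul_pow_sub_self_eq_one (q := q)
      (a := IntermediateField.AdjoinSimple.gen k x ^ q - IntermediateField.AdjoinSimple.gen k x)
      (by rw [← map_natCast (algebraMap k _), hq, map_zero]) (by simpa using hxy)
  have hsep := (IntermediateField.isSeparable_adjoin_simple_iff_isSeparable _ L).2 hy
  have htop' : IntermediateField.adjoin (IntermediateField.adjoin k {x}) {y} = ⊤ := by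
    apply IntermediateField.restrictScalars_injective k
    rw [IntermediateField.adjoin_simple_adjoin_simple, htop,
      IntermediateField.restrictScalars_top]
  rw [htop'] at hsep
  exact Algebra.IsSeparable.of_algHom _ _
    (IntermediateField.topEquiv (F := IntermediateField.adjoin k {x}) (E := L)).symm.toAlgHom

end Separability

/-! ### The function field and the space cut out by the conics -/

section CurveFunctionField

variable (F k : Type*) [Field k]

theorem coord_relation : (coordX F k ^ Nat.card F - coordX F k)
    * (coordY F k ^ Nat.card F - coordY F k) = 1 := by
  have h := AdjoinRoot.mk_self (f := curvePoly k (Nat.card F))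
  have h1 : AdjoinRoot.mk (curvePoly k (Nat.card F)) (curvePoly k (Nat.card F))
      = AdjoinRoot.mk (curvePoly k (Nat.card F)) (Polynomial.C (Polynomial.X ^ Nat.card F
        - Polynomial.X) * (Polynomial.X ^ Nat.card F - Polynomial.X) - 1) := rfl
  rw [h1, map_sub, map_mul, AdjoinRoot.mk_C, map_sub, map_sub, map_pow, map_pow, map_one,
    AdjoinRoot.mk_X] at h
  have h' := congrArg (algebraMap (CoordinateRing F k) (FunctionField F k)) h
  simp only [map_sub, map_mul, map_pow, map_one, map_zero] at h'
  exact sub_eq_zero.1 h'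

theorem aeval_coordX (f : k[X]) : Polynomial.aeval (coordX F k) f
    = algebraMap (CoordinateRing F k) (FunctionField F k) (AdjoinRoot.of _ f) := by
  have : (Polynomial.aeval (R := k) (coordX F k)).toRingHom
      = (algebraMap (CoordinateRing F k) (FunctionField F k)).comp (AdjoinRoot.of _) := by
    ext c
    · simp only [AlgHom.toRingHom_eq_coe, RingHom.comp_apply, RingHom.coe_coe, Polynomial.aeval_C]
      rfl
    · simp [coordX]
  exact DFunLike.congr_fun this f

variable [Field F] [Finite F]

theorem curvePoly_degree_ne_zero : (curvePoly k (Nat.card F)).degree ≠ 0 := by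
  have hq : 1 < Nat.card F := Finite.one_lt_card
  have hc : (curvePoly k (Nat.card F)).coeff (Nat.card F) ≠ 0 := by
    have h1 := FiniteField.X_pow_card_sub_X_ne_zero k hq
    rw [curvePoly, Polynomial.coeff_sub, Polynomial.coeff_C_mul, Polynomial.coeff_one,
      if_neg (by omega), Polynomial.coeff_sub, Polynomial.coeff_X_pow_self, Polynomial.coeff_X,
      if_neg hq.ne]
    simpa using h1
  intro h
  have := Polynomial.le_degree_of_ne_zero hc
  rw [h] at this
  have : Nat.card F ≤ 0 := by exact_mod_cast this
  omega

theorem transcendental_coordX : Transcendental k (coordX F k) := by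
  rw [transcendental_iff_injective]
  intro f g hfg
  rw [aeval_coordX, aeval_coordX] at hfg
  exact AdjoinRoot.of.injective_of_degree_ne_zero (curvePoly_degree_ne_zero F k)
    (IsFractionRing.injective _ _ hfg)

theorem adjoin_coord_eq_top : IntermediateField.adjoin k {coordX F k, coordY F k} = ⊤ := by
  rw [eq_top_iff]
  rintro z -
  have hx : coordX F k ∈ IntermediateField.adjoin k {coordX F k, coordY F k} :=
    IntermediateField.subset_adjoin _ _ (by simp)
  have hy : coordY F k ∈ IntermediateField.adjoin k {coordX F k, coordY F k} :=
    IntermediateField.subset_adjoin _ _ (by simp)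
  have hX : ∀ f : k[X], Polynomial.aeval (coordX F k) f
      ∈ IntermediateField.adjoin k {coordX F k, coordY F k} := fun f =>
    IntermediateField.algebra_adjoin_le_adjoin _ _
      (Algebra.adjoin_mono (by simp) (Polynomial.aeval_mem_adjoin_singleton k (coordX F k)))
  have hA : ∀ a : CoordinateRing F k, algebraMap _ (FunctionField F k) a
      ∈ IntermediateField.adjoin k {coordX F k, coordY F k} := by
    intro a
    induction a using AdjoinRoot.induction_on with
    | ih f =>
      induction f using Polynomial.induction_on' with
      | add f g hf hg => rw [map_add, map_add]; exact add_mem hf hg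
      | monomial n f =>
        rw [← Polynomial.C_mul_X_pow_eq_monomial, map_mul, map_mul, map_pow, map_pow,
          AdjoinRoot.mk_C, AdjoinRoot.mk_X, ← aeval_coordX]
        exact mul_mem (hX f) (pow_mem hy n)
  obtain ⟨a, b, -, rfl⟩ := IsFractionRing.div_surjective (A := CoordinateRing F k) z
  exact div_mem (hA a) (hA b)

theorem isSeparatingVariable_coordX (p : ℕ) [CharP k p] (hp : p ∣ Nat.card F) :
    IsSeparatingVariable k (coordX F k) :=
  ⟨transcendental_coordX F k, isSeparable_of_relation ((CharP.cast_eq_zero_iff k p _).2 hp)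
    (coord_relation F k) (adjoin_coord_eq_top F k)⟩

theorem restrictSystem_conicsThrough : restrictSystem F k (conicsThrough k)
    = Submodule.span k (Set.range ![1, coordX F k, coordY F k, coordX F k * coordY F k]) := by
  apply le_antisymm
  · rintro _ ⟨H, ⟨hH, h1, h2⟩, rfl⟩
    rw [AlgHom.toLinearMap_apply, MvPolynomial.aeval_def, MvPolynomial.eval₂_eq']
    have hdeg' : ∀ d ∈ H.support, d 0 + d 1 + d 2 = 2 := by
      intro d hd
      have := hH (MvPolynomial.mem_support_iff.1 hd)
      simpa [Finsupp.weight_apply, Finsupp.sum_fintype, Fin.sum_univ_three] using this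
    refine Submodule.sum_mem _ fun d hd => ?_
    rw [← Algebra.smul_def]
    refine Submodule.smul_mem _ _ (Submodule.subset_span ?_)
    have hdeg := hdeg' d hd
    -- At the `i`-th coordinate point only the square of the `i`-th variable survives, so vanishing
    -- there excludes that monomial.
    have hpt : ∀ (i : Fin 3) (v : Fin 3 → k), (∀ j, v j = if j = i then 1 else 0) →
        MvPolynomial.eval v H = 0 → d i ≠ 2 := by
      intro i v hv hev hdi
      rw [MvPolynomial.eval_eq', Finset.sum_eq_single d] at hev
      · have : ∏ j, v j ^ d j = 1 := by
          refine Finset.prod_eq_one fun j _ => ?_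
          by_cases hj : j = i
          · rw [hv, if_pos hj, one_pow]
          · have : d j = 0 := by
              fin_cases i <;> fin_cases j <;> simp at hj hdi ⊢ <;> omega
            rw [this, pow_zero]
        rw [this, mul_one] at hev
        exact MvPolynomial.mem_support_iff.1 hd hev
      · intro e he hed
        have hedeg : e 0 + e 1 + e 2 = 2 := hdeg' e he
        have : ∃ j, j ≠ i ∧ e j ≠ 0 := by
          by_contra! hcon
          apply hed
          ext j
          have h0 := hcon 0
          have h1 := hcon 1
          have h2 := hcon 2
          fin_cases i <;> fin_cases j <;> simp at h0 h1 h2 hdi ⊢ <;> omega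
        obtain ⟨j, hj, hej⟩ := this
        rw [Finset.prod_eq_zero (Finset.mem_univ j), mul_zero]
        rw [hv, if_neg hj, zero_pow hej]
      · exact fun h => absurd hd h
    have hd0 : d 0 ≠ 2 := hpt 0 _ (by intro j; fin_cases j <;> rfl) h1
    have hd1 : d 1 ≠ 2 := hpt 1 _ (by intro j; fin_cases j <;> rfl) h2
    rw [Fin.prod_univ_three]
    have : (d 0 = 0 ∧ d 1 = 0) ∨ (d 0 = 1 ∧ d 1 = 0) ∨ (d 0 = 0 ∧ d 1 = 1)
      ∨ (d 0 = 1 ∧ d 1 = 1) := by omega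
    rcases this with ⟨h0, h1⟩ | ⟨h0, h1⟩ | ⟨h0, h1⟩ | ⟨h0, h1⟩ <;> simp [h0, h1]
  · rw [Submodule.span_le]
    have hmem : ∀ i : Fin 3, ∀ j : Fin 3, (i ≠ j ∨ i = 2) →
        (MvPolynomial.X i * MvPolynomial.X j : MvPolynomial (Fin 3) k) ∈ conicsThrough k := by
      intro i j hij
      refine ⟨(MvPolynomial.isHomogeneous_X k i).mul (MvPolynomial.isHomogeneous_X k j), ?_, ?_⟩
      all_goals
        fin_cases i <;> fin_cases j <;> simp at hij ⊢
    rintro _ ⟨i, rfl⟩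
    fin_cases i
    · exact ⟨_, hmem 2 2 (by decide), by simp⟩
    · exact ⟨_, hmem 0 2 (by decide), by simp⟩
    · exact ⟨_, hmem 1 2 (by decide), by simp⟩
    · exact ⟨_, hmem 0 1 (by decide), by simp⟩

end CurveFunctionField

/-! ### Arbitrary bases, dimension and conclusion -/

section Main

variable {F k : Type*} [Field F] [Finite F] [Field k] [Finite k]

theorem isLeast_frobeniusMatrix_conicsThrough (p m : ℕ) (hp : 3 < p) [Fact p.Prime] [CharP k p]
    (hq : Nat.card F = p ^ m) (hm : m ≠ 0) {r : ℕ} (hr : 0 < r)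
    (hk : Nat.card k = Nat.card F ^ r) {τ : FunctionField F k}
    {D : ℕ → FunctionField F k →ₗ[k] FunctionField F k} (hD : IsHasseDerivatives k τ D)
    (f : Module.Basis (Fin 4) k (restrictSystem F k (conicsThrough k))) :
    IsLeast {μ : Lex (Fin 3 → ℕ) |
      (frobeniusMatrix (Nat.card k) D (fun j => (f j : FunctionField F k)) (ofLex μ)).det ≠ 0}
      (toLex ![0, 1, if r = 2 then Nat.card F else 2]) := by
  have : CharP (FunctionField F k) p :=
    charP_of_injective_algebraMap (algebraMap k (FunctionField F k)).injective p
  have h := hD.isLeast_of_relation p hp hq hm (transcendental_coordX F k) (coord_relation F k)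
    (adjoin_coord_eq_top F k) hr
  rw [← hk] at h
  have hli := linearIndependent_of_det_frobeniusMatrix_ne_zero D _ _ h.1
  let b := (Module.Basis.span hli).map
    (LinearEquiv.ofEq _ _ (restrictSystem_conicsThrough F k).symm)
  have hb : (fun j => (b j : FunctionField F k))
      = ![1, coordX F k, coordY F k, coordX F k * coordY F k] := by
    ext j
    simp [b, Module.Basis.span_apply]
  rw [← hb] at h
  convert h using 2
  ext μ
  exact ⟨det_frobeniusMatrix_ne_zero_of_basis D f b _,
    det_frobeniusMatrix_ne_zero_of_basis D b f _⟩

/-- Independence of `1, x, y, xy` comes from one nonzero Frobenius determinant, taken with respect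
to `x`. -/
theorem finrank_restrictSystem_conicsThrough (p m : ℕ) (hp : 3 < p) [Fact p.Prime] [CharP k p]
    (hq : Nat.card F = p ^ m) (hm : m ≠ 0) {r : ℕ} (hr : 0 < r)
    (hk : Nat.card k = Nat.card F ^ r) :
    Module.finrank k (restrictSystem F k (conicsThrough k)) = 4 := by
  have : CharP (FunctionField F k) p :=
    charP_of_injective_algebraMap (algebraMap k (FunctionField F k)).injective p
  obtain ⟨D, hD⟩ := (isSeparatingVariable_coordX F k p
    (hq ▸ dvd_pow_self p hm)).exists_isHasseDerivatives
  have h := hD.isLeast_of_relation p hp hq hm (transcendental_coordX F k) (coord_relation F k)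
    (adjoin_coord_eq_top F k) hr
  rw [← hk] at h
  have hli := linearIndependent_of_det_frobeniusMatrix_ne_zero D _ _ h.1
  rw [restrictSystem_conicsThrough, finrank_span_eq_card hli, Fintype.card_fin]

end Main

end ArtinMumford

end

/-- `F` is the finite field of order `q`, of characteristic `p > 3`, and `k` is the extension of
`F` of degree `r`. -/
theorem proposition5p7 (p : ℕ) (hp : 3 < p) (F : Type*) [Field F] [Finite F] [CharP F p]
    (k : Type*) [Field k] [Algebra F k] (r : ℕ) (hr : 0 < r) (hk : Module.finrank F k = r) :
    (∃ ν : Fin 3 → ℕ, ArtinMumford.IsFrobeniusOrderSequence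
      (ArtinMumford.restrictSystem F k (ArtinMumford.conicsThrough k)) ν) ∧
    (ArtinMumford.IsFrobeniusNonclassical
      (ArtinMumford.restrictSystem F k (ArtinMumford.conicsThrough k)) ↔ r = 2) := by
  have hfin : Module.Finite F k := Module.finite_of_finrank_pos (hk ▸ hr)
  have : Finite k := Module.finite_of_finite F
  have hF := Fintype.ofFinite F
  obtain ⟨⟨m, hm⟩, hpp, hq⟩ := FiniteField.card F p
  rw [← Nat.card_eq_fintype_card] at hq
  have : Fact p.Prime := ⟨hpp⟩
  have : CharP k p := charP_of_injective_algebraMap (algebraMap F k).injective p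
  have hcard : Nat.card k = Nat.card F ^ r := by rw [Module.natCard_eq_pow_finrank (K := F), hk]
  have hrank := ArtinMumford.finrank_restrictSystem_conicsThrough p m hp hq hm.ne' hr hcard
  have hsep := ArtinMumford.isSeparatingVariable_coordX F k p (hq ▸ dvd_pow_self p hm.ne')
  have hseq : ArtinMumford.IsFrobeniusOrderSequence
      (ArtinMumford.restrictSystem F k (ArtinMumford.conicsThrough k))
      ![0, 1, if r = 2 then Nat.card F else 2] := by
    refine ⟨hrank, ⟨_, hsep⟩, fun τ hτ f => ?_⟩
    obtain ⟨D, hD⟩ := hτ.exists_isHasseDerivatives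
    exact ⟨D, hD, ArtinMumford.isLeast_frobeniusMatrix_conicsThrough p m hp hq hm.ne' hr hcard
      hD f⟩
  refine ⟨⟨_, hseq⟩, ?_, ?_⟩
  · rintro ⟨N, ν, ⟨hN, -, hν⟩, hne⟩
    obtain rfl : N = 3 := by omega
    by_contra hr2
    have : Module.Finite k (ArtinMumford.restrictSystem F k (ArtinMumford.conicsThrough k)) :=
      Module.finite_of_finrank_pos (by omega)
    -- The computed minimum holds for every Hasse family, so uniqueness of `D` is not needed to
    -- compare the two minima.
    obtain ⟨D, hD, hleast⟩ := hν _ hsep (Module.finBasisOfFinrankEq k _ hrank)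
    have h := hleast.unique (ArtinMumford.isLeast_frobeniusMatrix_conicsThrough p m hp hq hm.ne'
      hr hcard hD _)
    rw [if_neg hr2] at h
    apply hne
    rw [toLex.injective h]
    ext i
    fin_cases i <;> rfl
  · intro hr2
    refine ⟨3, _, hseq, fun h => ?_⟩
    have h2 := congrFun h 2
    have hpq : p ≤ Nat.card F := by
      rw [hq]
      exact Nat.le_self_pow hm.ne' p
    rw [if_pos hr2] at h2
    -- Impossible, since `3 < p ≤ q`.
    have h3 : Nat.card F = 2 := h2
    omega
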